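/- Let $a<b$ be real numbers, let $m\ge 0$, and let $P(x)\in\mathbb R[x]^{m\times m}$ be a symmetric matrix of real univariate polynomials. Let $\deg P$ be the largest degree of an entry of $P$ (with $\deg P=0$ if $P=0$), let $d=\lfloor \deg(P)/2\rfloor$, let $y=(y_1,\dots,y_m)^T$ be a vector of variables, and let $p(x,y)=y^TP(x)y\in\mathbb R[x,y]$. Then $P(x)$ is positive semidefinite for every $x\in[a,b]$ if and only if there are polynomials $\lambda,\nu\in\mathbb R[x,y]$, each a finite sum of squares of polynomials in $\mathbb R[x,y]$, such that $$p(x,y)=\begin{cases}\lambda(x,y)+(x-a)(b-x)\,\nu(x,y), & \text{if }\deg P=2d,\\ (x-a)\,\lambda(x,y)+(b-x)\,\nu(x,y), & \text{if }\deg P=2d+1.\end{cases}$$ Moreover, if $P(x)$ is positive semidefinite for every $x\in[a,b]$, then such $\lambda,\nu$ can be chosen so that, for every $i$, each of $\lambda$ and $\nu$ has degree exactly $2$ in $y_i$ unless it does not involve $y_i$ (in which case its degree in $y_i$ is $0$), and so that $$\deg_x\lambda\le 2d,\qquad \deg_x\nu\le\begin{cases}2d-2, & \text{if }\deg P=2d,\\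 2d, & \text{if }\deg P=2d+1,\end{cases}$$ where for $\deg P=0$ the bound $\deg_x\nu\le -2$ means $\nu=0$. -/

import Mathlib

open Polynomial

/-- The degree of a matrix of univariate polynomials: the largest degree of an entry
(`0` for the zero matrix and for the empty matrix). -/
def polyMatrixDegree {m : ℕ} (P : Matrix (Fin m) (Fin m) ℝ[X]) : ℕ :=
  (Finset.univ : Finset (Fin m × Fin m)).sup fun ij => (P ij.1 ij.2).natDegree

/-- Real polynomials in the variables `x, y₁, …, y_m`: the variable `x` has index `none`
and `y_i` has index `some i`. -/
abbrev PolyXY (m : ℕ) : Type := MvPolynomial (Option (Fin m)) ℝ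

/-- The variable `x`. -/
noncomputable def varX (m : ℕ) : PolyXY m := MvPolynomial.X none

/-- The vector of variables `y = (y₁, …, y_m)`. -/
noncomputable def varY (m : ℕ) : Fin m → PolyXY m := fun i => MvPolynomial.X (some i)

/-- The scalar polynomial `p(x, y) = yᵀ P(x) y`. -/
noncomputable def quadFormPoly {m : ℕ} (P : Matrix (Fin m) (Fin m) ℝ[X]) : PolyXY m :=
  dotProduct (varY m) (Matrix.mulVec (P.map fun q => Polynomial.aeval (varX m) q) (varY m))

/-- `yᵀ P(x) y` is `lam + (x - a)(b - x) nu` if `deg P` is even, and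
`(x - a) lam + (b - x) nu` if `deg P` is odd, where `lam` and `nu` are sums of squares
of polynomials in `(x, y)`. -/
def IsIntervalCertificate {m : ℕ} (P : Matrix (Fin m) (Fin m) ℝ[X]) (a b : ℝ)
    (lam nu : PolyXY m) : Prop :=
  IsSumSq lam ∧ IsSumSq nu ∧
    (Even (polyMatrixDegree P) →
      quadFormPoly P =
        lam + (varX m - MvPolynomial.C a) * (MvPolynomial.C b - varX m) * nu) ∧
    (Odd (polyMatrixDegree P) →
      quadFormPoly P =
        (varX m - MvPolynomial.C a) * lam + (MvPolynomial.C b - varX m) * nu)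

/-! The core is the matrix Fejér–Riesz theorem `isPolyGram_of_posSemidefOnReals`: a complex matrix
polynomial, positive semidefinite on the real line, is `Aᴴ * A`. Its proof bounds entry `(i, j)` by
`d i + d j` and lowers the weights `d` by polynomial congruences. If the matrix of leading
coefficients is singular, a kernel vector gives a unimodular congruence lowering one weight
(`exists_reduction_of_det_eq_zero`). If it is nonsingular and the weights are not all zero, the
determinant is nonconstant; a kernel vector at a root `z` makes a column divisible by `X - z` and
the matching row by the conjugate factor, and both are cancelled (`exists_reduction_of_isRoot_det`).
A vanishing diagonal entry takes its row and column with it, and a constant matrix has a constant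
Gram factor.

For real matrices, the real and imaginary parts of `A` give a sum of squares, with degree bounds
because squares cannot cancel at the top (`exists_sum_mul_of_posSemidef`).

The interval is reached by `x = (a + b t²) / (1 + t²)`. After clearing denominators the matrix is a
polynomial in `t²`, so the even part of its sum of squares has the form `e eᵀ + s o oᵀ`, summed,
with `s = t² = (x - a) / (b - x)` (`exists_sum_halfLine`). Multiplying by a power of `b - x` gives
the two Markov–Lukács forms, according to the parity of that power. Contracting with `y` turns them
into the scalar identities; the converse is evaluation at a point. -/

section ComplexFactorization

open Matrix Filter Topology
open scoped ComplexOrder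

/-! ### Conjugation of coefficients and evaluation at real points -/

/-- Conjugation of the coefficients as a star operation on complex polynomials. -/
noncomputable instance complexPolynomialStarRing : StarRing ℂ[X] where
  star p := p.map (starRingEnd ℂ)
  star_involutive p := by ext n; simp [coeff_map]
  star_mul p q := by rw [Polynomial.map_mul, mul_comm]
  star_add p q := Polynomial.map_add _

lemma coeff_star_poly (p : ℂ[X]) (n : ℕ) : (star p).coeff n = star (p.coeff n) :=
  coeff_map _ _

lemma eval_ofReal_star (p : ℂ[X]) (x : ℝ) :
    eval (x : ℂ) (star p) = star (eval (x : ℂ) p) := by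
  change eval (x : ℂ) (p.map (starRingEnd ℂ)) = _
  have h := Polynomial.eval_map_apply (p := p) (starRingEnd ℂ) (x : ℂ)
  rw [Complex.conj_ofReal] at h
  exact h

lemma star_X_poly : star (X : ℂ[X]) = X := Polynomial.map_X _

lemma star_C_poly (z : ℂ) : star (C z : ℂ[X]) = C (star z) := Polynomial.map_C _

lemma natDegree_star_poly (p : ℂ[X]) : (star p).natDegree = p.natDegree :=
  natDegree_map _

/-- Two complex polynomials that agree at all but finitely many real points are equal. -/
lemma eq_of_eventually_eval_ofReal_eq {p q : ℂ[X]}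
    (h : ∀ᶠ x : ℝ in cofinite, eval (x : ℂ) p = eval (x : ℂ) q) : p = q := by
  refine eq_of_infinite_eval_eq p q ?_
  have h1 : Set.Infinite {x : ℝ | eval (x : ℂ) p = eval (x : ℂ) q} :=
    frequently_cofinite_iff_infinite.1 h.frequently
  refine (h1.image (f := fun x : ℝ => (x : ℂ)) (Complex.ofReal_injective.injOn)).mono ?_
  rintro _ ⟨x, hx, rfl⟩
  exact hx

/-! ### Scalar polynomials that are nonnegative on the real line -/

section Nonneg

/-- The quotient is the reflected polynomial at `x⁻¹`, whose constant term is `p.coeff n`. The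
general filter serves both ends of the line. -/
lemma tendsto_eval_div_pow {l : Filter ℝ} (hl : Tendsto (fun x : ℝ => x⁻¹) l (𝓝 0))
    (hl0 : ∀ᶠ x in l, x ≠ 0) (p : ℂ[X]) (n : ℕ) (hp : p.natDegree ≤ n) :
    Tendsto (fun x : ℝ => eval (x : ℂ) p / (x : ℂ) ^ n) l (𝓝 (p.coeff n)) := by
  have h1 : Tendsto (fun x : ℝ => eval ((x⁻¹ : ℝ) : ℂ) (p.reflect n)) l
      (𝓝 (eval ((0 : ℝ) : ℂ) (p.reflect n))) :=
    (((p.reflect n).continuous.comp Complex.continuous_ofReal).tendsto 0).comp hl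
  have h2 : eval ((0 : ℝ) : ℂ) (p.reflect n) = p.coeff n := by
    rw [Complex.ofReal_zero, ← coeff_zero_eq_eval_zero, coeff_reflect]
    simp [revAt_le]
  rw [h2] at h1
  refine h1.congr' ?_
  filter_upwards [hl0] with x hx
  have hx' : (x : ℂ) ≠ 0 := by exact_mod_cast hx
  let _ : Invertible (x : ℂ) := invertibleOfNonzero hx'
  have h3 := eval₂_reflect_mul_pow (RingHom.id ℂ) (x : ℂ) n p hp
  rw [invOf_eq_inv] at h3
  simp only [eval₂_id] at h3
  rw [eq_div_iff (pow_ne_zero _ hx'), Complex.ofReal_inv, h3]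

lemma nonneg_of_tendsto {α : Type*} {l : Filter α} [NeBot l] {f : α → ℂ} {z : ℂ}
    (hf : Tendsto f l (𝓝 z)) (h : ∀ᶠ x in l, 0 ≤ f x) : 0 ≤ z := by
  rw [Complex.nonneg_iff]
  constructor
  · refine ge_of_tendsto ((Complex.continuous_re.tendsto z).comp hf) ?_
    filter_upwards [h] with x hx using (Complex.nonneg_iff.1 hx).1
  · refine tendsto_nhds_unique (tendsto_const_nhds (x := (0 : ℝ)) (f := l)) ?_
    refine ((Complex.continuous_im.tendsto z).comp hf).congr' ?_
    filter_upwards [h] with x hx using (Complex.nonneg_iff.1 hx).2.symm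

/-- A polynomial that is nonnegative on the real line has no odd leading term. -/
lemma coeff_odd_eq_zero_of_nonneg {p : ℂ[X]} (h : ∀ᶠ x : ℝ in cofinite, 0 ≤ eval (x : ℂ) p)
    {k : ℕ} (hp : p.natDegree ≤ 2 * k + 1) : p.coeff (2 * k + 1) = 0 := by
  -- The limits of `p(x) / x ^ (2k+1)` at `-∞` and at `+∞` are the same coefficient, with opposite
  -- signs.
  apply le_antisymm
  · have h1 := tendsto_eval_div_pow (l := atBot) tendsto_inv_atBot_zero
      (eventually_ne_atBot 0) p _ hp
    rw [← neg_nonneg]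
    refine nonneg_of_tendsto h1.neg ?_
    filter_upwards [atBot_le_cofinite h, eventually_lt_atBot (0 : ℝ)] with x hx hx0
    have : -(eval (x : ℂ) p / (x : ℂ) ^ (2 * k + 1))
        = eval (x : ℂ) p * (((-x ^ (2 * k + 1))⁻¹ : ℝ) : ℂ) := by
      push_cast
      rw [inv_neg]; ring
    rw [this]
    refine mul_nonneg hx ?_
    have h2 : x ^ (2 * k + 1) < 0 := Odd.pow_neg ⟨k, rfl⟩ hx0
    have h3 : 0 ≤ (-x ^ (2 * k + 1))⁻¹ := by
      rw [inv_nonneg]; linarith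
    exact_mod_cast h3
  · have h1 := tendsto_eval_div_pow (l := atTop) tendsto_inv_atTop_zero
      (eventually_ne_atTop 0) p _ hp
    refine nonneg_of_tendsto h1 ?_
    filter_upwards [atTop_le_cofinite h, eventually_gt_atTop (0 : ℝ)] with x hx hx0
    rw [div_eq_mul_inv]
    refine mul_nonneg hx ?_
    have h3 : 0 ≤ (x ^ (2 * k + 1))⁻¹ := by positivity
    exact_mod_cast h3

lemma natDegree_le_of_coeff_eq_zero {R : Type*} [Semiring R] {p : R[X]} {n : ℕ}
    (h : p.natDegree ≤ n + 1) (h0 : p.coeff (n + 1) = 0) : p.natDegree ≤ n := by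
  by_contra hlt
  have h1 : p.natDegree = n + 1 := by omega
  rw [← h1, coeff_natDegree, leadingCoeff_eq_zero] at h0
  simp [h0] at h1

/-- A root of a polynomial that is nonnegative on the real line comes with its conjugate. -/
lemma exists_factor_of_nonneg {p : ℂ[X]} (h : ∀ᶠ x : ℝ in cofinite, 0 ≤ eval (x : ℂ) p)
    {z : ℂ} (hz : p.IsRoot z) : ∃ q, p = star (X - C z) * q * (X - C z) := by
  have hstar : star (X - C z) = X - C (star z) := by
    rw [star_sub, star_X_poly, star_C_poly]
  rw [hstar]
  obtain ⟨g, hg⟩ := dvd_iff_isRoot.2 hz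
  suffices h1 : g.IsRoot (star z) by
    obtain ⟨q, hq⟩ := dvd_iff_isRoot.2 h1
    exact ⟨q, by rw [hg, hq]; ring⟩
  -- At a real root `r`, the cofactor `g = p / (x - r)` is nonpositive on the left and nonnegative
  -- on the right, so it vanishes at `r`. A nonreal root has a different conjugate, which is a root
  -- of `p` because `p` is self-conjugate.
  by_cases hr : star z = z
  · obtain ⟨r, rfl⟩ := Complex.conj_eq_iff_real.1 hr
    rw [hr]
    have hcont : Tendsto (fun x : ℝ => eval (x : ℂ) g) (𝓝 r) (𝓝 (eval (r : ℂ) g)) :=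
      (g.continuous.comp Complex.continuous_ofReal).tendsto r
    have hev : ∀ x : ℝ, x ≠ r → eval (x : ℂ) g
        = eval (x : ℂ) p * (((x - r)⁻¹ : ℝ) : ℂ) := by
      intro x hx
      have : (x : ℂ) - r ≠ 0 := by
        rw [sub_ne_zero]; exact_mod_cast hx
      rw [hg]
      simp only [eval_mul, eval_sub, eval_X, eval_C]
      push_cast
      field_simp
    have hcof : ∀ᶠ x : ℝ in 𝓝[≠] r, 0 ≤ eval (x : ℂ) p := nhdsNE_le_cofinite r h
    apply le_antisymm
    · rw [← neg_nonneg]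
      refine nonneg_of_tendsto (l := 𝓝[<] r) (hcont.mono_left nhdsWithin_le_nhds).neg ?_
      filter_upwards [nhdsWithin_mono r (fun x (hx : x < r) => hx.ne) hcof,
        self_mem_nhdsWithin] with x hx hxr
      have hxr' : x < r := hxr
      rw [hev x hxr'.ne, ← mul_neg]
      refine mul_nonneg hx ?_
      have : 0 ≤ -(x - r)⁻¹ := by
        rw [← inv_neg, inv_nonneg]; linarith
      exact_mod_cast this
    · refine nonneg_of_tendsto (l := 𝓝[>] r) (hcont.mono_left nhdsWithin_le_nhds) ?_
      filter_upwards [nhdsWithin_mono r (fun x (hx : r < x) => hx.ne') hcof,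
        self_mem_nhdsWithin] with x hx hxr
      have hxr' : r < x := hxr
      rw [hev x hxr'.ne']
      refine mul_nonneg hx ?_
      have : 0 ≤ (x - r)⁻¹ := by
        rw [inv_nonneg]; linarith
      exact_mod_cast this
  · have hp : star p = p := by
      refine eq_of_eventually_eval_ofReal_eq ?_
      filter_upwards [h] with x hx
      rw [eval_ofReal_star]
      exact (IsSelfAdjoint.of_nonneg hx).star_eq
    have h2 : p.IsRoot (star z) := by
      have h3 := Polynomial.eval_map_apply (p := p) (starRingEnd ℂ) z
      rw [hz.eq_zero, map_zero] at h3
      change eval (starRingEnd ℂ z) p = 0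
      rw [← hp]
      exact h3
    rw [hg, root_mul] at h2
    refine h2.resolve_left ?_
    rw [root_X_sub_C]
    exact fun h => hr h.symm

end Nonneg

/-! ### Polynomial Gram matrices and positivity at almost all real points -/

section Gram

variable {ι κ : Type*}

/-- The polynomial matrix `P` is positive semidefinite at all but finitely many real points. -/
def PosSemidefOnReals (P : Matrix ι ι ℂ[X]) : Prop :=
  ∀ᶠ x : ℝ in cofinite, (P.map (eval (x : ℂ))).PosSemidef

lemma PosSemidefOnReals.star_apply {P : Matrix ι ι ℂ[X]} (h : PosSemidefOnReals P) (i j : ι) :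
    star (P i j) = P j i := by
  refine eq_of_eventually_eval_ofReal_eq ?_
  filter_upwards [h] with x hx
  rw [eval_ofReal_star]
  exact hx.isHermitian.apply j i

lemma PosSemidefOnReals.diag_nonneg {P : Matrix ι ι ℂ[X]} (h : PosSemidefOnReals P) (i : ι) :
    ∀ᶠ x : ℝ in cofinite, 0 ≤ eval (x : ℂ) (P i i) := by
  filter_upwards [h] with x hx using hx.diag_nonneg (i := i)

variable [Fintype ι]

/-- `P` is the Gram matrix of a finite family of polynomial vectors. -/
def IsPolyGram (P : Matrix ι ι ℂ[X]) : Prop :=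
  ∃ n : ℕ, ∃ A : Matrix (Fin n) ι ℂ[X], P = Aᴴ * A

lemma IsPolyGram.congr {P : Matrix ι ι ℂ[X]} (h : IsPolyGram P) (E : Matrix ι κ ℂ[X]) :
    IsPolyGram (Eᴴ * P * E) := by
  obtain ⟨n, A, rfl⟩ := h
  exact ⟨n, A * E, by simp only [conjTranspose_mul, Matrix.mul_assoc]⟩

lemma map_eval_conjTranspose_mul_mul (P : Matrix ι ι ℂ[X]) (E : Matrix ι κ ℂ[X]) (x : ℝ) :
    (Eᴴ * P * E).map (eval (x : ℂ))
      = (E.map (eval (x : ℂ)))ᴴ * P.map (eval (x : ℂ)) * E.map (eval (x : ℂ)) := by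
  have h1 : (Eᴴ * P * E).map (evalRingHom (x : ℂ)) = (Eᴴ.map (evalRingHom (x : ℂ)))
      * P.map (evalRingHom (x : ℂ)) * E.map (evalRingHom (x : ℂ)) := by
    rw [Matrix.map_mul, Matrix.map_mul]
  rw [← coe_evalRingHom, h1]
  congr 2
  ext i j
  simp [eval_ofReal_star]

lemma PosSemidefOnReals.congr [Fintype κ] {P : Matrix ι ι ℂ[X]} (h : PosSemidefOnReals P)
    (E : Matrix ι κ ℂ[X]) : PosSemidefOnReals (Eᴴ * P * E) := by
  filter_upwards [h] with x hx
  rw [map_eval_conjTranspose_mul_mul]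
  exact hx.conjTranspose_mul_mul_same _

/-- A positive semidefinite matrix annihilates every vector on which its form vanishes, here a basis
vector. -/
lemma PosSemidefOnReals.apply_eq_zero [DecidableEq ι] {P : Matrix ι ι ℂ[X]}
    (h : PosSemidefOnReals P) {j : ι} (hj : P j j = 0) (i : ι) : P i j = 0 := by
  refine eq_of_eventually_eval_ofReal_eq ?_
  filter_upwards [h] with x hx
  have h1 := (hx.dotProduct_mulVec_zero_iff (Pi.single j 1)).1 (by simp [hj])
  have h2 := congrFun h1 i
  simpa using h2

/-- A constant matrix which is positive semidefinite is a Gram matrix. -/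
lemma isPolyGram_of_natDegree_eq_zero [DecidableEq ι] {P : Matrix ι ι ℂ[X]}
    (h : PosSemidefOnReals P) (hd : ∀ i j, (P i j).natDegree = 0) : IsPolyGram P := by
  -- One good real point suffices, since the entries are constant.
  obtain ⟨x, hx⟩ := Filter.Eventually.exists h
  obtain ⟨B, hB⟩ : ∃ B : Matrix ι ι ℂ, P.map (eval (x : ℂ)) = Bᴴ * B := by
    open scoped MatrixOrder in
    exact CStarAlgebra.nonneg_iff_eq_star_mul_self.1 hx.nonneg
  have hP : P = (B.map C)ᴴ * 1 * B.map C := by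
    ext1 i j
    have h1 := congrFun (congrFun hB i) j
    rw [eq_C_of_natDegree_eq_zero (hd i j)]
    rw [map_apply, eq_C_of_natDegree_eq_zero (hd i j), eval_C] at h1
    rw [h1]
    simp [Matrix.mul_apply, star_C_poly]
  rw [hP]
  refine IsPolyGram.congr ⟨Fintype.card ι,
    (1 : Matrix ι ι ℂ[X]).submatrix (Fintype.equivFin ι).symm id, ?_⟩ _
  rw [conjTranspose_submatrix, submatrix_mul_equiv]
  simp

end Gram

/-! ### Matrix Fejér–Riesz factorization by descent on the weights -/

section Factorization

/-- Entrywise bounds by `d i + d j` follow from those off row and column `j`, those in column `j`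
and the one at the diagonal entry. -/
lemma natDegree_le_update_pred {ι : Type*} [DecidableEq ι] {P : Matrix ι ι ℂ[X]}
    (hP : ∀ i k, star (P i k) = P k i)
    {d : ι → ℕ} {j : ι} (hj : d j ≠ 0)
    (h : ∀ i k, i ≠ j → k ≠ j → (P i k).natDegree ≤ d i + d k)
    (hcol : ∀ i, i ≠ j → (P i j).natDegree ≤ d i + d j - 1)
    (hdiag : (P j j).natDegree ≤ d j + d j - 2) (i k : ι) :
    (P i k).natDegree
      ≤ Function.update d j (d j - 1) i + Function.update d j (d j - 1) k := by
  by_cases hi : i = j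
  · by_cases hk : k = j
    · subst hi; subst hk; simp; omega
    · have := hcol k hk
      rw [← hP, natDegree_star_poly]
      subst hi; simp [hk]; omega
  · by_cases hk : k = j
    · have := hcol i hi
      subst hk; simp [hi]; omega
    · simpa [hi, hk] using h i k hi hk

variable {ι : Type} [Fintype ι] [DecidableEq ι]

/-- The coefficients at the highest degrees that the weights `d` allow. -/
def weightedCoeff (P : Matrix ι ι ℂ[X]) (d : ι → ℕ) : Matrix ι ι ℂ :=
  of fun i j => (P i j).coeff (d i + d j)

lemma coeff_prod_of_natDegree_le_weights {α R : Type*} [CommSemiring R] (s : Finset α)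
    (f : α → R[X]) (n : α → ℕ) (h : ∀ i ∈ s, (f i).natDegree ≤ n i) :
    (∏ i ∈ s, f i).coeff (∑ i ∈ s, n i) = ∏ i ∈ s, (f i).coeff (n i) := by
  classical
  induction s using Finset.induction_on with
  | empty => simp
  | insert a s ha ih =>
    rw [Finset.prod_insert ha, Finset.sum_insert ha, Finset.prod_insert ha,
      coeff_mul_add_eq_of_natDegree_le (h a (Finset.mem_insert_self _ _)),
      ih fun i hi => h i (Finset.mem_insert_of_mem hi)]
    refine (natDegree_prod_le _ _).trans (Finset.sum_le_sum fun i hi => ?_)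
    exact h i (Finset.mem_insert_of_mem hi)

/-- In every permutation term the weights add up to twice `∑ i, d i`, so the top coefficients
multiply. A nonsingular leading matrix thus forces the determinant to have that degree. -/
lemma coeff_det_eq_det_weightedCoeff {P : Matrix ι ι ℂ[X]} {d : ι → ℕ}
    (h : ∀ i j, (P i j).natDegree ≤ d i + d j) :
    P.det.coeff (∑ i, d i + ∑ i, d i) = (weightedCoeff P d).det := by
  rw [det_apply, det_apply, finsetSum_coeff]
  refine Finset.sum_congr rfl fun σ _ => ?_
  have h1 : ∑ i, d i + ∑ i, d i = ∑ i, (d (σ i) + d i) := by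
    rw [Finset.sum_add_distrib, Equiv.sum_comp σ d]
  rw [coeff_smul, h1, coeff_prod_of_natDegree_le_weights _ _ _ fun i _ => h (σ i) i]
  rfl

/-- The identity matrix with its column `j` replaced by `w`. -/
def replaceColumn {R : Type*} [Zero R] [One R] (j : ι) (w : ι → R) : Matrix ι ι R :=
  of fun a k => if k = j then w a else (Pi.single k 1 : ι → R) a

/-- This makes the congruence unimodular as soon as `w j` is a nonzero constant. -/
lemma det_replaceColumn {R : Type*} [CommRing R] (j : ι) (w : ι → R) :
    (replaceColumn j w).det = w j := by
  have h : replaceColumn j w = (1 : Matrix ι ι R).updateCol j w := by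
    ext a k
    by_cases hk : k = j
    · subst hk; simp [replaceColumn]
    · simp [replaceColumn, hk, Matrix.one_apply, Pi.single_apply]
  rw [h, ← cramer_apply, cramer_one]
  simp

lemma conj_replaceColumn_apply_of_ne (P : Matrix ι ι ℂ[X]) {j i k : ι} (w : ι → ℂ[X])
    (hi : i ≠ j) (hk : k ≠ j) :
    ((replaceColumn j w)ᴴ * P * replaceColumn j w) i k = P i k := by
  simp [Matrix.mul_apply, replaceColumn, hi, hk, Pi.single_apply, apply_ite (star : ℂ[X] → ℂ[X])]

lemma conj_replaceColumn_apply_right (P : Matrix ι ι ℂ[X]) {j i : ι} (w : ι → ℂ[X])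
    (hi : i ≠ j) :
    ((replaceColumn j w)ᴴ * P * replaceColumn j w) i j = (P *ᵥ w) i := by
  simp [Matrix.mul_apply, replaceColumn, hi, Pi.single_apply, apply_ite (star : ℂ[X] → ℂ[X]),
    mulVec, dotProduct]

lemma conj_replaceColumn_apply_self (P : Matrix ι ι ℂ[X]) (j : ι) (w : ι → ℂ[X]) :
    ((replaceColumn j w)ᴴ * P * replaceColumn j w) j j = ∑ i, star (w i) * (P *ᵥ w) i := by
  rw [Matrix.mul_assoc, Matrix.mul_apply]
  refine Finset.sum_congr rfl fun i _ => ?_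
  simp [replaceColumn, Matrix.mul_apply, mulVec, dotProduct]

lemma IsPolyGram.of_conj_of_isUnit_det {P T : Matrix ι ι ℂ[X]} (hT : IsUnit T.det)
    (h : IsPolyGram (Tᴴ * P * T)) : IsPolyGram P := by
  have h1 := h.congr T⁻¹
  have h2 : T * T⁻¹ = 1 := mul_nonsing_inv T hT
  have h3 : (T⁻¹)ᴴ * Tᴴ = 1 := by rw [← conjTranspose_mul, h2, conjTranspose_one]
  have h4 : (T⁻¹)ᴴ * (Tᴴ * P * T) * T⁻¹ = P := by
    calc (T⁻¹)ᴴ * (Tᴴ * P * T) * T⁻¹ = ((T⁻¹)ᴴ * Tᴴ) * P * (T * T⁻¹) := by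
          simp only [Matrix.mul_assoc]
      _ = P := by rw [h2, h3, Matrix.one_mul, Matrix.mul_one]
  rwa [h4] at h1

/-- A vanishing diagonal entry can be removed. -/
lemma isPolyGram_of_diag_eq_zero {P : Matrix ι ι ℂ[X]} (hP : PosSemidefOnReals P) {j : ι}
    (hj : P j j = 0)
    (h : IsPolyGram (P.submatrix (Subtype.val : {i // i ≠ j} → ι) Subtype.val)) :
    IsPolyGram P := by
  have hcol : ∀ i, P i j = 0 := hP.apply_eq_zero hj
  have hrow : ∀ i, P j i = 0 := fun i => by
    rw [← hP.star_apply i j, hcol, star_zero]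
  obtain ⟨n, A, hA⟩ := h
  refine ⟨n, of fun k i => if hi : i = j then 0 else A k ⟨i, hi⟩, ?_⟩
  ext1 i l
  by_cases hi : i = j
  · subst hi; simp [Matrix.mul_apply, hrow]
  by_cases hl : l = j
  · subst hl; simp [Matrix.mul_apply, hcol]
  have h1 := congrFun (congrFun hA ⟨i, hi⟩) ⟨l, hl⟩
  simpa [Matrix.mul_apply, hi, hl] using h1

lemma natDegree_le_of_mul_X_sub_C {g : ℂ[X]} {z : ℂ} {n : ℕ}
    (h : (g * (X - C z)).natDegree ≤ n + 1) : g.natDegree ≤ n := by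
  by_cases hg : g = 0
  · simp [hg]
  rw [natDegree_mul hg (X_sub_C_ne_zero z), natDegree_X_sub_C] at h
  omega

/-- The hypothesis on `w` says that it has weighted degree at most `d j`: the gain `d k` in column
`k` of `P` is compensated by the smaller degree of `w k`. -/
lemma natDegree_mulVec_le {ι : Type*} [Fintype ι] {P : Matrix ι ι ℂ[X]} {d : ι → ℕ}
    (hd : ∀ i j, (P i j).natDegree ≤ d i + d j) {w : ι → ℂ[X]} {j : ι}
    (hw : ∀ i, w i = 0 ∨ (w i).natDegree + d i ≤ d j) (i : ι) :
    ((P *ᵥ w) i).natDegree ≤ d i + d j := by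
  refine natDegree_sum_le_of_forall_le _ _ fun k _ => ?_
  rcases hw k with h | h
  · simp [h]
  · have := hd i k
    exact (natDegree_mul_le (p := P i k)).trans (by omega)

lemma natDegree_star_dotProduct_mulVec_le {ι : Type*} [Fintype ι] {P : Matrix ι ι ℂ[X]} {d : ι → ℕ}
    (hd : ∀ i j, (P i j).natDegree ≤ d i + d j) {w : ι → ℂ[X]} {j : ι}
    (hw : ∀ i, w i = 0 ∨ (w i).natDegree + d i ≤ d j) :
    (∑ i, star (w i) * (P *ᵥ w) i).natDegree ≤ d j + d j := by
  refine natDegree_sum_le_of_forall_le _ _ fun k _ => ?_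
  rcases hw k with h | h
  · simp [h]
  · have := natDegree_mulVec_le hd hw k
    refine natDegree_mul_le.trans ?_
    rw [natDegree_star_poly]
    omega

lemma sum_update_pred_lt {d : ι → ℕ} {j : ι} (hj : d j ≠ 0) :
    ∑ i, (Function.update d j (d j - 1) i + 1) < ∑ i, (d i + 1) := by
  refine Finset.sum_lt_sum (fun i _ => ?_) ⟨j, Finset.mem_univ _, ?_⟩
  · by_cases hi : i = j
    · subst hi; simp
    · simp [hi]
  · simp; omega

/-- The summand `1` makes the induction measure decrease even when the removed index has weight
zero. -/
lemma sum_ne_lt (d : ι → ℕ) (j : ι) : ∑ i : {i // i ≠ j}, (d i + 1) < ∑ i, (d i + 1) := by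
  rw [← Finset.sum_subtype (Finset.univ.erase j) (by simp) (fun i => d i + 1),
    ← Finset.add_sum_erase _ _ (Finset.mem_univ j)]
  omega

/-- The entries of a diagonal congruence. -/
lemma diagonal_conj_apply (P : Matrix ι ι ℂ[X]) (e : ι → ℂ[X]) (i k : ι) :
    ((diagonal e)ᴴ * P * diagonal e) i k = star (e i) * P i k * e k := by
  rw [mul_diagonal, diagonal_conjTranspose, diagonal_mul]
  rfl

/-- Positivity on the reals is not affected by a diagonal congruence with nonzero entries. -/
lemma PosSemidefOnReals.of_diagonal_conj {P : Matrix ι ι ℂ[X]} {e : ι → ℂ[X]}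
    (he : ∀ i, ∀ᶠ x : ℝ in cofinite, eval (x : ℂ) (e i) ≠ 0)
    (h : PosSemidefOnReals ((diagonal e)ᴴ * P * diagonal e)) : PosSemidefOnReals P := by
  filter_upwards [h, eventually_all.2 he] with x hx hex
  rw [map_eval_conjTranspose_mul_mul] at hx
  have hU : IsUnit ((diagonal e).map (eval (x : ℂ))) := by
    rw [isUnit_iff_isUnit_det, diagonal_map (eval_zero), det_diagonal, isUnit_iff_ne_zero,
      Finset.prod_ne_zero_iff]
    exact fun i _ => hex i
  exact hU.posSemidef_star_left_conjugate_iff.1 hx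

/-- A vector `u ≠ 0` has an index in its support with maximal weight. -/
lemma exists_max_weight {ι : Type*} [Fintype ι] {u : ι → ℂ} (hu : u ≠ 0) (d : ι → ℕ) :
    ∃ j, u j ≠ 0 ∧ ∀ i, u i ≠ 0 → d i ≤ d j := by
  obtain ⟨i, hi⟩ := Function.ne_iff.1 hu
  obtain ⟨j, hj, hmax⟩ := Finset.exists_max_image (Finset.univ.filter fun i => u i ≠ 0) d
    ⟨i, by simpa using hi⟩
  exact ⟨j, by simpa using hj, fun i hi => hmax i (by simpa using hi)⟩

/-- The reduction at infinity: a degenerate leading coefficient matrix allows a unimodular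
congruence that lowers a weight. -/
lemma exists_reduction_of_det_eq_zero {P : Matrix ι ι ℂ[X]} {d : ι → ℕ}
    (hd : ∀ i j, (P i j).natDegree ≤ d i + d j) (hP : PosSemidefOnReals P)
    (hdet : (weightedCoeff P d).det = 0) :
    ∃ (j : ι) (T : Matrix ι ι ℂ[X]), IsUnit T.det ∧
      ((Tᴴ * P * T) j j = 0 ∧ (∀ i k, i ≠ j → k ≠ j → ((Tᴴ * P * T) i k).natDegree ≤ d i + d k) ∨
      d j ≠ 0 ∧ ∀ i k, ((Tᴴ * P * T) i k).natDegree
        ≤ Function.update d j (d j - 1) i + Function.update d j (d j - 1) k) := by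
  obtain ⟨u, hu, hker⟩ := exists_mulVec_eq_zero_iff.2 hdet
  obtain ⟨j, hj, hmax⟩ := exists_max_weight hu d
  -- The powers of `X` align the weights, so the top coefficients of `P *ᵥ w` are the leading matrix
  -- applied to `u`, which is zero. Maximality of `d j` on the support of `u` makes the subtraction
  -- exact.
  set w : ι → ℂ[X] := fun i => C (u i) * X ^ (d j - d i) with hwdef
  have hw : ∀ i, w i = 0 ∨ (w i).natDegree + d i ≤ d j := fun i => by
    by_cases hi : u i = 0
    · left; simp [hwdef, hi]
    · right
      have := hmax i hi
      have h1 : (w i).natDegree ≤ d j - d i := natDegree_C_mul_X_pow_le _ _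
      omega
  have hcoeff : ∀ i, ((P *ᵥ w) i).coeff (d i + d j) = 0 := fun i => by
    refine Eq.trans ?_ (congrFun hker i)
    simp only [mulVec, dotProduct, finsetSum_coeff]
    refine Finset.sum_congr rfl fun k _ => ?_
    by_cases hk : u k = 0
    · simp [hwdef, hk]
    · have := hmax k hk
      have h1 : d i + d j = (d i + d k) + (d j - d k) := by omega
      rw [hwdef, h1]
      simp only
      rw [← mul_assoc, coeff_mul_X_pow, coeff_mul_C]
      rfl
  have hcoeff' : (∑ i, star (w i) * (P *ᵥ w) i).coeff (d j + d j) = 0 := by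
    rw [finsetSum_coeff]
    refine Finset.sum_eq_zero fun k _ => ?_
    by_cases hk : u k = 0
    · simp [hwdef, hk]
    · have := hmax k hk
      have h1 : d j + d j = (d j - d k) + (d k + d j) := by omega
      have h2 : (star (w k)).natDegree ≤ d j - d k := by
        rw [natDegree_star_poly]; exact natDegree_C_mul_X_pow_le _ _
      rw [h1, coeff_mul_add_eq_of_natDegree_le h2 (natDegree_mulVec_le hd hw k), hcoeff, mul_zero]
  have hdiag := natDegree_star_dotProduct_mulVec_le hd hw
  rw [← conj_replaceColumn_apply_self P j w] at hcoeff' hdiag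
  have hR := hP.congr (replaceColumn j w)
  have hne : ∀ i k, i ≠ j → k ≠ j →
      (((replaceColumn j w)ᴴ * P * replaceColumn j w) i k).natDegree ≤ d i + d k :=
    fun i k hi hk => by
      rw [conj_replaceColumn_apply_of_ne P w hi hk]; exact hd i k
  refine ⟨j, replaceColumn j w, ?_, ?_⟩
  · rw [det_replaceColumn]
    simpa [hwdef] using hj
  by_cases hj0 : d j = 0
  · refine Or.inl ⟨?_, hne⟩
    rw [hj0] at hcoeff' hdiag
    rw [eq_C_of_natDegree_le_zero hdiag, hcoeff', C_0]
  · refine Or.inr ⟨hj0, natDegree_le_update_pred hR.star_apply hj0 hne ?_ ?_⟩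
    · intro i hi
      rw [conj_replaceColumn_apply_right P w hi]
      have h1 : d i + d j = (d i + d j - 1) + 1 := by omega
      refine natDegree_le_of_coeff_eq_zero ?_ ?_
      · rw [← h1]; exact natDegree_mulVec_le hd hw i
      · rw [← h1]; exact hcoeff i
    -- The diagonal degree must drop by two: once because the top coefficient vanishes, once more
    -- because the next degree is odd and the entry is nonnegative on the line.
    · have h1 : d j + d j = (2 * (d j - 1) + 1) + 1 := by omega
      have h2 : d j + d j - 2 = 2 * (d j - 1) := by omega
      rw [h1] at hdiag hcoeff'
      have h3 := natDegree_le_of_coeff_eq_zero hdiag hcoeff'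
      rw [h2]
      exact natDegree_le_of_coeff_eq_zero h3 (coeff_odd_eq_zero_of_nonneg (hR.diag_nonneg j) h3)

/-- The reduction at a root of the determinant: after a unimodular congruence, a row and a column
are divisible by a linear factor and its conjugate. -/
lemma exists_reduction_of_isRoot_det {P : Matrix ι ι ℂ[X]} {d : ι → ℕ}
    (hd : ∀ i j, (P i j).natDegree ≤ d i + d j) (hP : PosSemidefOnReals P) {z : ℂ}
    (hz : P.det.IsRoot z) :
    ∃ (j : ι) (T : Matrix ι ι ℂ[X]), IsUnit T.det ∧
      ((Tᴴ * P * T) j j = 0 ∧ (∀ i k, i ≠ j → k ≠ j → ((Tᴴ * P * T) i k).natDegree ≤ d i + d k) ∨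
      d j ≠ 0 ∧ ∃ Q D : Matrix ι ι ℂ[X], Tᴴ * P * T = Dᴴ * Q * D ∧ PosSemidefOnReals Q ∧
        ∀ i k, (Q i k).natDegree
        ≤ Function.update d j (d j - 1) i + Function.update d j (d j - 1) k) := by
  have hdet : (P.map (eval z)).det = 0 := by
    have h := RingHom.map_det (evalRingHom z) P
    rw [coe_evalRingHom, hz.eq_zero] at h
    exact h.symm
  obtain ⟨u, hu, hker⟩ := exists_mulVec_eq_zero_iff.2 hdet
  obtain ⟨j, hj, hmax⟩ := exists_max_weight hu d
  -- A constant vector suffices here, since divisibility by `X - C z` is sought and not a drop in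
  -- degree; `d j` is maximal so that the degree bounds survive.
  set w : ι → ℂ[X] := fun i => C (u i) with hwdef
  have hw : ∀ i, w i = 0 ∨ (w i).natDegree + d i ≤ d j := fun i => by
    by_cases hi : u i = 0
    · left; simp [hwdef, hi]
    · right
      simpa [hwdef] using hmax i hi
  have hroot : ∀ i, ((P *ᵥ w) i).IsRoot z := fun i => by
    have h := congrFun hker i
    simp only [mulVec, dotProduct, map_apply, Pi.zero_apply] at h
    simpa [IsRoot, mulVec, dotProduct, eval_finsetSum, hwdef] using h
  have hdiag := natDegree_star_dotProduct_mulVec_le hd hw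
  have hrootdiag : (∑ i, star (w i) * (P *ᵥ w) i).IsRoot z := by
    rw [IsRoot, eval_finsetSum]
    exact Finset.sum_eq_zero fun i _ => by rw [eval_mul, (hroot i).eq_zero, mul_zero]
  rw [← conj_replaceColumn_apply_self P j w] at hrootdiag hdiag
  have hR := hP.congr (replaceColumn j w)
  have hcol : ∀ i, i ≠ j →
      (((replaceColumn j w)ᴴ * P * replaceColumn j w) i j).natDegree ≤ d i + d j :=
    fun i hi => by
      rw [conj_replaceColumn_apply_right P w hi]; exact natDegree_mulVec_le hd hw i
  have hrootcol : ∀ i, i ≠ j →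
      (((replaceColumn j w)ᴴ * P * replaceColumn j w) i j).IsRoot z :=
    fun i hi => by rw [conj_replaceColumn_apply_right P w hi]; exact hroot i
  have hne : ∀ i k, i ≠ j → k ≠ j →
      (((replaceColumn j w)ᴴ * P * replaceColumn j w) i k).natDegree ≤ d i + d k :=
    fun i k hi hk => by
      rw [conj_replaceColumn_apply_of_ne P w hi hk]; exact hd i k
  have hT : IsUnit (replaceColumn j w).det := by
    rw [det_replaceColumn]
    simpa [hwdef] using hj
  refine ⟨j, replaceColumn j w, hT, ?_⟩
  generalize (replaceColumn j w)ᴴ * P * replaceColumn j w = R at *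
  obtain ⟨q, hq⟩ := exists_factor_of_nonneg (hR.diag_nonneg j) hrootdiag
  by_cases hRj : R j j = 0
  · exact Or.inl ⟨hRj, hne⟩
  have hstar : star (X - C z) = X - C (star z) := by
    rw [star_sub, star_X_poly, star_C_poly]
  have hq0 : q ≠ 0 := by
    rintro rfl
    exact hRj (by rw [hq]; simp)
  have hqdeg : q.natDegree + 2 ≤ d j + d j := by
    rw [hq, hstar, natDegree_mul (mul_ne_zero (X_sub_C_ne_zero _) hq0) (X_sub_C_ne_zero _),
      natDegree_mul (X_sub_C_ne_zero _) hq0, natDegree_X_sub_C, natDegree_X_sub_C] at hdiag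
    omega
  -- A nonzero diagonal entry with two linear factors has degree at least two.
  have hj0 : d j ≠ 0 := by omega
  have hg : ∀ i, ∃ g, i ≠ j → R i j = g * (X - C z) := fun i => by
    by_cases hi : i = j
    · exact ⟨0, fun h => absurd hi h⟩
    · obtain ⟨g, hg⟩ := dvd_iff_isRoot.2 (hrootcol i hi)
      exact ⟨g, fun _ => by rw [hg, mul_comm]⟩
  choose g hg using hg
  -- `R` with `X - C z` cancelled from column `j` and its conjugate from row `j`.
  set Q : Matrix ι ι ℂ[X] := of fun i k =>
    if i = j then (if k = j then q else star (g k)) else if k = j then g i else R i k with hQ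
  set e : ι → ℂ[X] := Function.update 1 j (X - C z) with he
  have hRQ : R = (diagonal e)ᴴ * Q * diagonal e := by
    ext1 i k
    rw [diagonal_conj_apply]
    by_cases hi : i = j
    · by_cases hk : k = j
      · rw [hi, hk, hq]; simp [hQ, he]
      · rw [hi, ← hR.star_apply, hg k hk, star_mul]
        simp [hQ, he, hk]
    · by_cases hk : k = j
      · rw [hk, hg i hi]; simp [hQ, he, hi]
      · simp [hQ, he, hi, hk]
  -- The cancelled factor can vanish at one real point at most, `z.re`; this is where positivity at
  -- all but finitely many points is convenient.
  have hQpos : PosSemidefOnReals Q := by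
    rw [hRQ] at hR
    refine hR.of_diagonal_conj fun i => ?_
    by_cases hi : i = j
    · have hfin : ∀ᶠ x : ℝ in cofinite, x ∉ ({z.re} : Set ℝ) :=
        (Set.finite_singleton z.re).eventually_cofinite_notMem
      filter_upwards [hfin] with x hx h0
      rw [hi, he, Function.update_self, eval_sub, eval_X, eval_C, sub_eq_zero] at h0
      exact hx (by rw [← h0]; simp)
    · simp [he, hi]
  refine Or.inr ⟨hj0, Q, diagonal e, hRQ, hQpos,
    natDegree_le_update_pred hQpos.star_apply hj0 ?_ ?_ ?_⟩
  · intro i k hi hk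
    simpa [hQ, hi, hk] using hne i k hi hk
  · intro i hi
    have h1 : Q i j = g i := by simp [hQ, hi]
    rw [h1]
    refine natDegree_le_of_mul_X_sub_C (z := z) ?_
    rw [← hg i hi]
    have := hcol i hi
    omega
  · have h1 : Q j j = q := by simp [hQ]
    rw [h1]
    omega

/-- **Matrix Fejér–Riesz theorem**: a complex matrix polynomial that is positive semidefinite on
the real line is of the form `Aᴴ * A`. -/
theorem isPolyGram_of_posSemidefOnReals (N : ℕ) : ∀ {ι : Type} [Fintype ι] [DecidableEq ι]
    (P : Matrix ι ι ℂ[X]) (d : ι → ℕ), ∑ i, (d i + 1) ≤ N →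
    (∀ i j, (P i j).natDegree ≤ d i + d j) → PosSemidefOnReals P → IsPolyGram P := by
  -- The index type varies in the induction, since dropping a zero diagonal entry shrinks it.
  induction N using Nat.strong_induction_on with
  | _ N ih =>
  intro ι _ _ P d hN hd hP
  have hdrop : ∀ {R : Matrix ι ι ℂ[X]} {j : ι}, PosSemidefOnReals R → R j j = 0 →
      (∀ i k, i ≠ j → k ≠ j → (R i k).natDegree ≤ d i + d k) → IsPolyGram R := by
    intro R j hR hj hdeg
    refine isPolyGram_of_diag_eq_zero hR hj
      (ih _ ((sum_ne_lt d j).trans_le hN) _ (fun i => d i) le_rfl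
        (fun i k => hdeg i k i.2 k.2) ?_)
    filter_upwards [hR] with x hx using hx.submatrix _
  by_cases hdet : (weightedCoeff P d).det = 0
  · obtain ⟨j, T, hT, ⟨h1, h2⟩ | ⟨hj, h2⟩⟩ := exists_reduction_of_det_eq_zero hd hP hdet
    · exact (hdrop (hP.congr T) h1 h2).of_conj_of_isUnit_det hT
    · exact (ih _ ((sum_update_pred_lt hj).trans_le hN) _ _ le_rfl h2
        (hP.congr T)).of_conj_of_isUnit_det hT
  by_cases hd0 : ∀ i, d i = 0
  · exact isPolyGram_of_natDegree_eq_zero hP fun i j => by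
      have := hd i j
      rw [hd0, hd0] at this
      omega
  · push Not at hd0
    obtain ⟨i, hi⟩ := hd0
    -- The leading matrix is nonsingular and some weight is positive, so the determinant is
    -- nonconstant and has a complex root.
    rw [← coeff_det_eq_det_weightedCoeff hd] at hdet
    have h1 := le_natDegree_of_ne_zero hdet
    have h2 : d i ≤ ∑ i, d i := Finset.single_le_sum (fun _ _ => Nat.zero_le _) (Finset.mem_univ i)
    obtain ⟨z, hz⟩ := Complex.exists_root (f := P.det)
      (natDegree_pos_iff_degree_pos.1 (by omega))
    obtain ⟨j, T, hT, ⟨h1, h2⟩ | ⟨hj, Q, D, hQ, hQpos, h2⟩⟩ :=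
      exists_reduction_of_isRoot_det hd hP hz
    · exact (hdrop (hP.congr T) h1 h2).of_conj_of_isUnit_det hT
    · refine IsPolyGram.of_conj_of_isUnit_det hT ?_
      rw [hQ]
      exact (ih _ ((sum_update_pred_lt hj).trans_le hN) _ _ le_rfl h2 hQpos).congr D

end Factorization

end ComplexFactorization

/-! ### Descent from complex to real coefficients -/

section RealFactorization

open Matrix Filter

lemma exists_re_im_poly (p : ℂ[X]) : ∃ f g : ℝ[X],
    p = f.map Complex.ofRealHom + C Complex.I * g.map Complex.ofRealHom := by
  induction p using Polynomial.induction_on' with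
  | add p q hp hq =>
    obtain ⟨f, g, rfl⟩ := hp
    obtain ⟨f', g', rfl⟩ := hq
    exact ⟨f + f', g + g', by simp only [Polynomial.map_add]; ring⟩
  | monomial n z =>
    refine ⟨monomial n z.re, monomial n z.im, ?_⟩
    rw [map_monomial, map_monomial, C_mul_monomial, ← map_add]
    congr 1
    simp [mul_comm Complex.I, Complex.re_add_im]

lemma coeff_re_map_add_I_mul_map (f g : ℝ[X]) (n : ℕ) :
    ((f.map Complex.ofRealHom + C Complex.I * g.map Complex.ofRealHom).coeff n).re
      = f.coeff n := by
  simp [coeff_map]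

lemma star_map_ofRealHom (f : ℝ[X]) :
    star (f.map Complex.ofRealHom) = f.map Complex.ofRealHom := by
  ext n
  simp [coeff_star_poly, coeff_map]

lemma posSemidef_map_ofReal {ι : Type*} [Fintype ι] [DecidableEq ι] {M : Matrix ι ι ℝ}
    (h : M.PosSemidef) : open scoped ComplexOrder in (M.map Complex.ofRealHom).PosSemidef := by
  open scoped ComplexOrder in
  obtain ⟨B, rfl⟩ : ∃ B : Matrix ι ι ℝ, M = Bᴴ * B := by
    open scoped MatrixOrder in
    exact CStarAlgebra.nonneg_iff_eq_star_mul_self.1 h.nonneg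
  have h1 : (Bᴴ * B).map Complex.ofRealHom
      = (B.map Complex.ofRealHom)ᴴ * B.map Complex.ofRealHom := by
    rw [Matrix.map_mul]
    congr 1
    ext i j
    simp
  rw [h1]
  exact posSemidef_conjTranspose_mul_self _

/-- Leading terms of squares do not cancel. -/
lemma natDegree_le_of_natDegree_sum_sq_le {κ : Type*} [Fintype κ] (f : κ → ℝ[X]) {d : ℕ}
    (h : (∑ k, f k * f k).natDegree ≤ 2 * d) (k : κ) : (f k).natDegree ≤ d := by
  by_contra hk
  push Not at hk
  -- At twice the largest degree, the coefficient of the sum is a sum of real squares that includes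
  -- the square of a leading coefficient.
  obtain ⟨l, -, hl⟩ := Finset.exists_max_image Finset.univ (fun k => (f k).natDegree)
    ⟨k, Finset.mem_univ k⟩
  have hlk := hl k (Finset.mem_univ k)
  have h1 : (∑ k, f k * f k).coeff ((f l).natDegree + (f l).natDegree) = 0 :=
    coeff_eq_zero_of_natDegree_lt (by omega)
  rw [finsetSum_coeff] at h1
  have h2 : ∀ m, (f m * f m).coeff ((f l).natDegree + (f l).natDegree)
      = (f m).coeff (f l).natDegree * (f m).coeff (f l).natDegree := fun m =>
    coeff_mul_add_eq_of_natDegree_le (hl m (Finset.mem_univ m)) (hl m (Finset.mem_univ m))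
  simp only [h2] at h1
  have h3 := (Finset.sum_eq_zero_iff_of_nonneg (fun m _ => mul_self_nonneg _)).1 h1 l
    (Finset.mem_univ l)
  rw [mul_self_eq_zero, coeff_natDegree, leadingCoeff_eq_zero] at h3
  rw [h3, natDegree_zero] at hlk
  omega

/-- **Matrix Fejér–Riesz theorem over the reals**: a real matrix polynomial that is positive
semidefinite on the real line is a sum of squares. -/
theorem exists_sum_mul_of_posSemidef {ι : Type} [Fintype ι] [DecidableEq ι]
    (Q : Matrix ι ι ℝ[X]) (d : ℕ) (hd : ∀ i j, (Q i j).natDegree ≤ 2 * d)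
    (hQ : ∀ t : ℝ, (Q.map (eval t)).PosSemidef) :
    ∃ (κ : Type) (_ : Fintype κ) (A : κ → ι → ℝ[X]),
      (∀ i j, Q i j = ∑ k, A k i * A k j) ∧ ∀ k i, (A k i).natDegree ≤ d := by
  -- The degree bound follows from the diagonal entries, which are sums of squares.
  suffices h : ∃ (κ : Type) (_ : Fintype κ) (A : κ → ι → ℝ[X]),
      ∀ i j, Q i j = ∑ k, A k i * A k j by
    obtain ⟨κ, _, A, hA⟩ := h
    refine ⟨κ, _, A, hA, fun k i => ?_⟩
    refine natDegree_le_of_natDegree_sum_sq_le (fun k => A k i) ?_ k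
    rw [← hA]
    exact hd i i
  have hpos : PosSemidefOnReals (Q.map (Polynomial.map Complex.ofRealHom)) := by
    refine Eventually.of_forall fun t => ?_
    convert posSemidef_map_ofReal (hQ t) using 1
    ext i j
    simpa using eval_map_apply (p := Q i j) Complex.ofRealHom t
  obtain ⟨n, A, hA⟩ := isPolyGram_of_posSemidefOnReals _ _ (fun _ => d) le_rfl
    (fun i j => by
      rw [map_apply, natDegree_map, ← two_mul]
      exact hd i j) hpos
  choose f g hfg using fun k i => exists_re_im_poly (A k i)
  -- With `A = f + i g`, the real part of `Aᴴ * A` is `fᵀ f + gᵀ g`.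
  refine ⟨Fin n ⊕ Fin n, inferInstance, Sum.elim f g, fun i j => ?_⟩
  have h1 : (Q i j).map Complex.ofRealHom
      = (∑ k, (f k i * f k j + g k i * g k j)).map Complex.ofRealHom
        + C Complex.I * (∑ k, (f k i * g k j - g k i * f k j)).map Complex.ofRealHom := by
    have h2 := congrFun (congrFun hA i) j
    rw [map_apply] at h2
    rw [h2, Matrix.mul_apply, Polynomial.map_sum, Polynomial.map_sum, Finset.mul_sum,
      ← Finset.sum_add_distrib]
    refine Finset.sum_congr rfl fun k _ => ?_
    rw [conjTranspose_apply, hfg k i, hfg k j, star_add, star_mul, star_map_ofRealHom,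
      star_map_ofRealHom, star_C_poly]
    have hI : (C Complex.I : ℂ[X]) * C Complex.I = -1 := by
      rw [← C_mul, Complex.I_mul_I, C_neg, C_1]
    have hs : (C (star Complex.I) : ℂ[X]) = -C Complex.I := by
      rw [← C_neg]; congr 1; exact Complex.conj_I
    rw [hs]
    simp only [Polynomial.map_add, Polynomial.map_sub, Polynomial.map_mul]
    linear_combination -((g k i).map Complex.ofRealHom * (g k j).map Complex.ofRealHom) * hI
  rw [Fintype.sum_sum_type]
  simp only [Sum.elim_inl, Sum.elim_inr]
  rw [← Finset.sum_add_distrib]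
  ext m
  have h3 := congrArg (fun p => (coeff p m).re) h1
  simp only [coeff_re_map_add_I_mul_map] at h3
  rw [← h3]
  simp [coeff_map]

end RealFactorization

/-! ### From the real line to the interval -/

section Interval

open Matrix Filter

/-- The form `∑ fₙ uⁿ v ^ (D - n)`, the homogenization of `f` in degree `D` at `(u, v)`. -/
noncomputable def homogEval (D : ℕ) (f u v : ℝ[X]) : ℝ[X] :=
  ∑ n ∈ Finset.range (D + 1), C (f.coeff n) * u ^ n * v ^ (D - n)

lemma eval_homogEval {D : ℕ} {f : ℝ[X]} (hf : f.natDegree ≤ D) (u v : ℝ[X]) {x : ℝ}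
    (hv : eval x v ≠ 0) :
    eval x (homogEval D f u v) = eval x v ^ D * eval (eval x u / eval x v) f := by
  rw [homogEval, eval_finsetSum, eval_eq_sum_range' (Nat.lt_succ_of_le hf), Finset.mul_sum]
  refine Finset.sum_congr rfl fun n hn => ?_
  have h1 : eval x v ^ D = eval x v ^ n * eval x v ^ (D - n) := by
    rw [← pow_add]; congr 1; have := Finset.mem_range.1 hn; omega
  simp only [eval_mul, eval_pow, eval_C]
  rw [h1, div_pow]
  field_simp

lemma natDegree_homogEval_le (D : ℕ) (f : ℝ[X]) {u v : ℝ[X]} {r : ℕ} (hu : u.natDegree ≤ r)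
    (hv : v.natDegree ≤ r) : (homogEval D f u v).natDegree ≤ D * r := by
  refine natDegree_sum_le_of_forall_le _ _ fun n hn => ?_
  have hn' : n ≤ D := Nat.lt_succ_iff.1 (Finset.mem_range.1 hn)
  have h1 : (C (f.coeff n) * u ^ n).natDegree ≤ n * r :=
    (natDegree_C_mul_le _ _).trans (natDegree_pow_le_of_le n hu)
  have h2 : (v ^ (D - n)).natDegree ≤ (D - n) * r := natDegree_pow_le_of_le _ hv
  refine natDegree_mul_le.trans ((add_le_add h1 h2).trans_eq ?_)
  rw [← add_mul]; congr 1; omega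

lemma expand_homogEval (p D : ℕ) (f u v : ℝ[X]) :
    expand ℝ p (homogEval D f u v) = homogEval D f (expand ℝ p u) (expand ℝ p v) := by
  simp [homogEval, map_sum, expand_C]

lemma contract_two_sum {κ : Type*} (s : Finset κ) (f : κ → ℝ[X]) :
    contract 2 (∑ k ∈ s, f k) = ∑ k ∈ s, contract 2 (f k) := by
  ext n
  simp [coeff_contract, finsetSum_coeff]

/-- The decomposition of a polynomial into its even and odd parts. -/
lemma expand_contract_add (f : ℝ[X]) :
    expand ℝ 2 (contract 2 f) + X * expand ℝ 2 (contract 2 f.divX) = f := by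
  ext n
  rcases Nat.even_or_odd' n with ⟨k, rfl | rfl⟩
  · rw [coeff_add, coeff_expand_mul' two_pos, coeff_contract two_ne_zero, mul_comm 2 k]
    rcases k with _ | k
    · simp
    · rw [show (k + 1) * 2 = (2 * k + 1) + 1 by ring, coeff_X_mul, coeff_expand two_pos,
        if_neg (by omega), add_zero]
  · rw [coeff_add, coeff_X_mul, coeff_expand_mul' two_pos, coeff_contract two_ne_zero, coeff_divX,
      coeff_expand two_pos, if_neg (by omega), zero_add, mul_comm 2 k]

/-- Write each factor as `f₀(X²) + X f₁(X²)`. The cross terms are odd and `contract 2` discards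
them; the product of the odd parts keeps a factor `X²`, which becomes `X`. -/
lemma contract_two_mul (f g : ℝ[X]) : contract 2 (f * g)
    = contract 2 f * contract 2 g + X * (contract 2 f.divX * contract 2 g.divX) := by
  have h : f * g = expand ℝ 2 (contract 2 f * contract 2 g
        + X * (contract 2 f.divX * contract 2 g.divX))
      + X * expand ℝ 2 (contract 2 f * contract 2 g.divX + contract 2 f.divX * contract 2 g) := by
    conv_lhs => rw [← expand_contract_add f, ← expand_contract_add g]
    simp only [map_add, map_mul, expand_X]
    ring
  ext n
  rw [coeff_contract two_ne_zero, h, coeff_add, coeff_expand_mul two_pos]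
  rcases n with _ | n
  · simp
  · rw [show (n + 1) * 2 = (2 * n + 1) + 1 by ring, coeff_X_mul, coeff_expand two_pos,
      if_neg (by omega), add_zero]

lemma natDegree_contract_two_le {f : ℝ[X]} {n : ℕ} (h : f.natDegree ≤ 2 * n + 1) :
    (contract 2 f).natDegree ≤ n := by
  rw [natDegree_le_iff_coeff_eq_zero]
  intro m hm
  rw [coeff_contract two_ne_zero]
  exact coeff_eq_zero_of_natDegree_lt (by omega)

/-- A matrix polynomial that is positive semidefinite on `[a, b]`, written in the coordinate
`s = (x - a) / (b - x)`. -/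
lemma exists_sum_halfLine {ι : Type} [Fintype ι] [DecidableEq ι] {P : Matrix ι ι ℝ[X]} {N : ℕ}
    (hN : ∀ i j, (P i j).natDegree ≤ N) {a b : ℝ} (hab : a < b)
    (hP : ∀ x ∈ Set.Icc a b, (P.map (eval x)).PosSemidef) :
    ∃ (κ : Type) (_ : Fintype κ) (e o : κ → ι → ℝ[X]),
      (∀ i j, ∀ x ∈ Set.Ioo a b, (b - a) ^ N * eval x (P i j) = (b - x) ^ N * ∑ k,
        (eval ((x - a) / (b - x)) (e k i) * eval ((x - a) / (b - x)) (e k j)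
        + (x - a) / (b - x) *
          (eval ((x - a) / (b - x)) (o k i) * eval ((x - a) / (b - x)) (o k j)))) ∧
      (∀ k i, (e k i).natDegree ≤ N / 2) ∧ (N = 0 → ∀ k i, o k i = 0) ∧
      ∀ k i, (o k i).natDegree ≤ (N - 1) / 2 := by
  -- `Q(t) = (1 + t²) ^ N P((a + b t²) / (1 + t²))`, where the argument of `P` stays in `[a, b]` for
  -- real `t`.
  set Q : Matrix ι ι ℝ[X] := of fun i j => homogEval N (P i j) (C a + C b * X ^ 2) (1 + X ^ 2)
    with hQdef
  have hQdeg : ∀ i j, (Q i j).natDegree ≤ 2 * N := fun i j => by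
    rw [mul_comm]
    refine natDegree_homogEval_le _ _ ?_ ?_ <;> compute_degree
  have hQ : ∀ t : ℝ, (Q.map (eval t)).PosSemidef := fun t => by
    have ht : (0 : ℝ) < 1 + t ^ 2 := by positivity
    have h1 : Q.map (eval t)
        = ((1 + t ^ 2) ^ N) • P.map (eval ((a + b * t ^ 2) / (1 + t ^ 2))) := by
      ext i j
      have h2 := eval_homogEval (hN i j) (C a + C b * X ^ 2) (1 + X ^ 2) (x := t)
        (by simpa using ht.ne')
      simpa [hQdef] using h2
    rw [h1]
    refine (hP _ ⟨?_, ?_⟩).smul (by positivity)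
    · rw [le_div_iff₀ ht]; nlinarith [sq_nonneg t]
    · rw [div_le_iff₀ ht]; nlinarith [sq_nonneg t]
  obtain ⟨κ, _, A, hA, hAdeg⟩ := exists_sum_mul_of_posSemidef Q N hQdeg hQ
  -- The even and odd parts of `A`, as polynomials in `s = t²`.
  refine ⟨κ, inferInstance, fun k i => contract 2 (A k i), fun k i => contract 2 (A k i).divX, ?_,
    fun k i => ?_, fun h0 k i => ?_, fun k i => ?_⟩
  · intro i j x hx
    have hbx : 0 < b - x := by linarith [hx.2]
    have hba : 0 < b - a := by linarith
    have h1 : homogEval N (P i j) (C a + C b * X) (1 + X) = ∑ k,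
        (contract 2 (A k i) * contract 2 (A k j)
          + X * (contract 2 (A k i).divX * contract 2 (A k j).divX)) := by
      have h2 : expand ℝ 2 (homogEval N (P i j) (C a + C b * X) (1 + X)) = Q i j := by
        rw [expand_homogEval]
        simp [hQdef, expand_C]
      simp only [← contract_two_mul]
      rw [← contract_two_sum, ← hA, ← h2, contract_expand _ two_ne_zero]
    have h3 := congrArg (eval ((x - a) / (b - x))) h1
    have h4 : eval ((x - a) / (b - x)) (1 + X : ℝ[X]) = (b - a) / (b - x) := by
      simp only [eval_add, eval_one, eval_X]
      field_simp; ring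
    have h5 : eval ((x - a) / (b - x)) (C a + C b * X : ℝ[X]) / ((b - a) / (b - x)) = x := by
      simp only [eval_add, eval_C, eval_mul, eval_X]
      field_simp; ring
    rw [eval_homogEval (hN i j) _ _ (by rw [h4]; positivity), h4, h5] at h3
    simp only [eval_finsetSum, eval_add, eval_mul, eval_X] at h3
    rw [← h3, div_pow]
    field_simp
  · have := hAdeg k i
    exact natDegree_contract_two_le (by omega)
  -- For `N = 0` the truncated bound `(N - 1) / 2 = 0` would still allow constants; the odd part
  -- vanishes because `A` is constant.
  · have := hAdeg k i
    rw [h0] at this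
    simp only
    rw [eq_C_of_natDegree_le_zero this, divX_C]
    ext n; simp [coeff_contract]
  · have := hAdeg k i
    refine natDegree_contract_two_le ?_
    rw [natDegree_divX_eq_natDegree_tsub_one]
    omega

lemma eq_of_eval_eq_on_Ioo {a b : ℝ} (hab : a < b) {p q : ℝ[X]}
    (h : ∀ x ∈ Set.Ioo a b, eval x p = eval x q) : p = q :=
  eq_of_infinite_eval_eq p q ((Set.Ioo_infinite hab).mono h)

/-- The constant `(b - a) ^ N` is absorbed into the squares by scaling each factor by `r`. -/
lemma exists_mul_self_mul_pow_eq_one {c : ℝ} (hc : 0 < c) (N : ℕ) : ∃ r : ℝ, r * r * c ^ N = 1 := by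
  refine ⟨√((c ^ N)⁻¹), ?_⟩
  rw [Real.mul_self_sqrt (by positivity)]
  exact inv_mul_cancel₀ (by positivity)

/-- **Markov–Lukács theorem for matrix polynomials**, even degree. -/
theorem exists_interval_sum_even {ι : Type} [Fintype ι] [DecidableEq ι] {P : Matrix ι ι ℝ[X]}
    {d : ℕ} (hd : ∀ i j, (P i j).natDegree ≤ 2 * d) {a b : ℝ} (hab : a < b)
    (hP : ∀ x ∈ Set.Icc a b, (P.map (eval x)).PosSemidef) :
    ∃ (κ : Type) (_ : Fintype κ) (E O : κ → ι → ℝ[X]),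
      (∀ i j, P i j = ∑ k, E k i * E k j + (X - C a) * (C b - X) * ∑ k, O k i * O k j) ∧
      (∀ k i, (E k i).natDegree ≤ d) ∧ (d = 0 → ∀ k i, O k i = 0) ∧
      ∀ k i, (O k i).natDegree ≤ d - 1 := by
  obtain ⟨κ, _, e, o, heo, he, ho0, ho⟩ := exists_sum_halfLine hd hab hP
  obtain ⟨r, hr⟩ := exists_mul_self_mul_pow_eq_one (sub_pos.2 hab) (2 * d)
  have he' : ∀ k i, (e k i).natDegree ≤ d := fun k i => by have := he k i; omega
  have ho' : ∀ k i, (o k i).natDegree ≤ d - 1 := fun k i => by have := ho k i; omega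
  have hu : (X - C a : ℝ[X]).natDegree ≤ 1 := by compute_degree
  have hv : (C b - X : ℝ[X]).natDegree ≤ 1 := by compute_degree
  -- Each `e` takes a factor `(b - x) ^ d` from `(b - x) ^ (2d)`. Each `o` takes only `(b - x) ^ (d
  -- - 1)`; of the remaining `(b - x)²`, one factor clears the denominator of `s` and one stays in
  -- the weight.
  refine ⟨κ, inferInstance, fun k i => C r * homogEval d (e k i) (X - C a) (C b - X),
    fun k i => C r * homogEval (d - 1) (o k i) (X - C a) (C b - X), fun i j => ?_,
    fun k i => ?_, fun h0 k i => ?_, fun k i => ?_⟩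
  · refine eq_of_eval_eq_on_Ioo hab fun x hx => ?_
    have hbx : 0 < b - x := by linarith [hx.2]
    have hev : eval x (C b - X : ℝ[X]) = b - x := by simp
    have heu : eval x (X - C a : ℝ[X]) = x - a := by simp
    have h1 : eval x (P i j) = r * r * ((b - a) ^ (2 * d) * eval x (P i j)) := by
      rw [← mul_assoc, hr, one_mul]
    rw [h1, heo i j x hx]
    simp only [eval_add, eval_mul, eval_finsetSum, eval_C]
    rw [Finset.mul_sum, Finset.mul_sum, Finset.mul_sum, ← Finset.sum_add_distrib]
    refine Finset.sum_congr rfl fun k _ => ?_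
    rw [eval_homogEval (he' k i) _ _ (by rw [hev]; exact hbx.ne'),
      eval_homogEval (he' k j) _ _ (by rw [hev]; exact hbx.ne'),
      eval_homogEval (ho' k i) _ _ (by rw [hev]; exact hbx.ne'),
      eval_homogEval (ho' k j) _ _ (by rw [hev]; exact hbx.ne'), hev, heu]
    rcases d with _ | d
    · simp only [ho0 rfl, eval_zero]
      ring
    · have h2 : (b - x) ^ (2 * (d + 1)) * ((x - a) / (b - x))
          = (x - a) * (b - x) * ((b - x) ^ d * (b - x) ^ d) := by
        field_simp
        ring
      rw [Nat.add_sub_cancel]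
      linear_combination (r * r * (eval ((x - a) / (b - x)) (o k i)
        * eval ((x - a) / (b - x)) (o k j))) * h2
  · exact (natDegree_C_mul_le _ _).trans (by simpa using natDegree_homogEval_le d (e k i) hu hv)
  · simp [h0, ho0, homogEval]
  · exact (natDegree_C_mul_le _ _).trans
      (by simpa using natDegree_homogEval_le (d - 1) (o k i) hu hv)

/-- **Markov–Lukács theorem for matrix polynomials**, odd degree. -/
theorem exists_interval_sum_odd {ι : Type} [Fintype ι] [DecidableEq ι] {P : Matrix ι ι ℝ[X]}
    {d : ℕ} (hd : ∀ i j, (P i j).natDegree ≤ 2 * d + 1) {a b : ℝ} (hab : a < b)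
    (hP : ∀ x ∈ Set.Icc a b, (P.map (eval x)).PosSemidef) :
    ∃ (κ : Type) (_ : Fintype κ) (E O : κ → ι → ℝ[X]),
      (∀ i j, P i j = (X - C a) * ∑ k, E k i * E k j + (C b - X) * ∑ k, O k i * O k j) ∧
      (∀ k i, (E k i).natDegree ≤ d) ∧ ∀ k i, (O k i).natDegree ≤ d := by
  obtain ⟨κ, _, e, o, heo, he, -, ho⟩ := exists_sum_halfLine hd hab hP
  obtain ⟨r, hr⟩ := exists_mul_self_mul_pow_eq_one (sub_pos.2 hab) (2 * d + 1)
  have he' : ∀ k i, (e k i).natDegree ≤ d := fun k i => by have := he k i; omega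
  have ho' : ∀ k i, (o k i).natDegree ≤ d := fun k i => by have := ho k i; omega
  have hu : (X - C a : ℝ[X]).natDegree ≤ 1 := by compute_degree
  have hv : (C b - X : ℝ[X]).natDegree ≤ 1 := by compute_degree
  -- The power `2d + 1` leaves one factor `b - x`: it remains as the weight of the `e` terms and
  -- turns `s` into `x - a` for the `o` terms, so the roles are exchanged.
  refine ⟨κ, inferInstance, fun k i => C r * homogEval d (o k i) (X - C a) (C b - X),
    fun k i => C r * homogEval d (e k i) (X - C a) (C b - X), fun i j => ?_,
    fun k i => ?_, fun k i => ?_⟩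
  · refine eq_of_eval_eq_on_Ioo hab fun x hx => ?_
    have hbx : 0 < b - x := by linarith [hx.2]
    have hev : eval x (C b - X : ℝ[X]) = b - x := by simp
    have heu : eval x (X - C a : ℝ[X]) = x - a := by simp
    have h1 : eval x (P i j) = r * r * ((b - a) ^ (2 * d + 1) * eval x (P i j)) := by
      rw [← mul_assoc, hr, one_mul]
    rw [h1, heo i j x hx]
    simp only [eval_add, eval_mul, eval_finsetSum, eval_C]
    rw [Finset.mul_sum, Finset.mul_sum, Finset.mul_sum, Finset.mul_sum, ← Finset.sum_add_distrib]
    refine Finset.sum_congr rfl fun k _ => ?_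
    rw [eval_homogEval (he' k i) _ _ (by rw [hev]; exact hbx.ne'),
      eval_homogEval (he' k j) _ _ (by rw [hev]; exact hbx.ne'),
      eval_homogEval (ho' k i) _ _ (by rw [hev]; exact hbx.ne'),
      eval_homogEval (ho' k j) _ _ (by rw [hev]; exact hbx.ne'), hev, heu]
    have h2 : (b - x) ^ (2 * d + 1) * ((x - a) / (b - x))
        = (x - a) * ((b - x) ^ d * (b - x) ^ d) := by
      field_simp
      ring
    linear_combination (r * r * (eval ((x - a) / (b - x)) (o k i)
        * eval ((x - a) / (b - x)) (o k j))) * h2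
  · exact (natDegree_C_mul_le _ _).trans (by simpa using natDegree_homogEval_le d (o k i) hu hv)
  · exact (natDegree_C_mul_le _ _).trans (by simpa using natDegree_homogEval_le d (e k i) hu hv)

end Interval

/-! ### Scalar certificates and their degrees -/

section Certificate

open Matrix

/-- The polynomial `v(x)ᵀ y`. -/
noncomputable def linearFormPoly {m : ℕ} (v : Fin m → ℝ[X]) : PolyXY m :=
  ∑ i, aeval (varX m) (v i) * varY m i

/-- The sum of the squares of the polynomials `v(x)ᵀ y`, where `v` runs over a finite family. -/
noncomputable def sumSqForms {m : ℕ} {κ : Type} [Fintype κ] (E : κ → Fin m → ℝ[X]) : PolyXY m :=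
  ∑ k, linearFormPoly (E k) * linearFormPoly (E k)

variable {m : ℕ} {κ : Type} [Fintype κ]

lemma isSumSq_sumSqForms (E : κ → Fin m → ℝ[X]) : IsSumSq (sumSqForms E) :=
  IsSumSq.sum fun _ _ => IsSumSq.mul_self _

lemma quadFormPoly_eq_sum (P : Matrix (Fin m) (Fin m) ℝ[X]) :
    quadFormPoly P = ∑ i, ∑ j, aeval (varX m) (P i j) * (varY m i * varY m j) := by
  simp only [quadFormPoly, dotProduct, mulVec, Finset.mul_sum, map_apply]
  exact Finset.sum_congr rfl fun i _ => Finset.sum_congr rfl fun j _ => by ring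

lemma sumSqForms_eq_sum (E : κ → Fin m → ℝ[X]) :
    sumSqForms E
      = ∑ i, ∑ j, aeval (varX m) (∑ k, E k i * E k j) * (varY m i * varY m j) := by
  simp only [sumSqForms, linearFormPoly, Finset.sum_mul_sum]
  simp only [map_sum, map_mul, Finset.sum_mul]
  rw [Finset.sum_comm]
  refine Finset.sum_congr rfl fun i _ => ?_
  rw [Finset.sum_comm]
  exact Finset.sum_congr rfl fun j _ => Finset.sum_congr rfl fun k _ => by ring

lemma quadFormPoly_eq_add {P : Matrix (Fin m) (Fin m) ℝ[X]} {κ' : Type} [Fintype κ']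
    {E : κ → Fin m → ℝ[X]} {O : κ' → Fin m → ℝ[X]} (f g : ℝ[X])
    (h : ∀ i j, P i j = f * ∑ k, E k i * E k j + g * ∑ k, O k i * O k j) :
    quadFormPoly P
      = aeval (varX m) f * sumSqForms E + aeval (varX m) g * sumSqForms O := by
  rw [quadFormPoly_eq_sum, sumSqForms_eq_sum, sumSqForms_eq_sum]
  simp only [Finset.mul_sum (s := (Finset.univ : Finset (Fin m))), ← Finset.sum_add_distrib]
  refine Finset.sum_congr rfl fun i _ => Finset.sum_congr rfl fun j _ => ?_
  rw [h, map_add, map_mul, map_mul]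
  ring

lemma degreeOf_none_aeval_varX_le (q : ℝ[X]) :
    (aeval (varX m) q).degreeOf none ≤ q.natDegree := by
  rw [aeval_eq_sum_range]
  refine (MvPolynomial.degreeOf_sum_le _ _ _).trans (Finset.sup_le fun n hn => ?_)
  rw [MvPolynomial.smul_eq_C_mul]
  refine (MvPolynomial.degreeOf_C_mul_le _ _ _).trans ?_
  refine (MvPolynomial.degreeOf_pow_le _ _ _).trans ?_
  rw [varX, MvPolynomial.degreeOf_X, if_pos rfl, mul_one]
  exact Nat.lt_succ_iff.1 (Finset.mem_range.1 hn)

lemma degreeOf_some_aeval_varX (q : ℝ[X]) (i : Fin m) :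
    (aeval (varX m) q).degreeOf (some i) = 0 := by
  rw [aeval_eq_sum_range, ← Nat.le_zero]
  refine (MvPolynomial.degreeOf_sum_le _ _ _).trans (Finset.sup_le fun n _ => ?_)
  rw [MvPolynomial.smul_eq_C_mul]
  refine (MvPolynomial.degreeOf_C_mul_le _ _ _).trans ?_
  refine (MvPolynomial.degreeOf_pow_le _ _ _).trans ?_
  rw [varX, MvPolynomial.degreeOf_X, if_neg (by simp), mul_zero]

lemma degreeOf_none_linearFormPoly_le {v : Fin m → ℝ[X]} {d : ℕ}
    (hv : ∀ i, (v i).natDegree ≤ d) : (linearFormPoly v).degreeOf none ≤ d := by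
  refine (MvPolynomial.degreeOf_sum_le _ _ _).trans (Finset.sup_le fun i _ => ?_)
  refine (MvPolynomial.degreeOf_mul_le _ _ _).trans ?_
  rw [varY, MvPolynomial.degreeOf_X, if_neg (by simp), add_zero]
  exact (degreeOf_none_aeval_varX_le _).trans (hv i)

lemma degreeOf_some_linearFormPoly_le (v : Fin m → ℝ[X]) (i : Fin m) :
    (linearFormPoly v).degreeOf (some i) ≤ if v i = 0 then 0 else 1 := by
  refine (MvPolynomial.degreeOf_sum_le _ _ _).trans (Finset.sup_le fun j _ => ?_)
  by_cases hv : v j = 0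
  · simp [hv]
  refine (MvPolynomial.degreeOf_mul_le _ _ _).trans ?_
  rw [degreeOf_some_aeval_varX, varY, MvPolynomial.degreeOf_X, zero_add]
  by_cases hij : i = j
  · subst hij; simp [hv]
  · simp [hij]

lemma degreeOf_sumSqForms_le {E : κ → Fin m → ℝ[X]} {s : Option (Fin m)} {d : ℕ}
    (h : ∀ k, (linearFormPoly (E k)).degreeOf s ≤ d) : (sumSqForms E).degreeOf s ≤ 2 * d := by
  refine (MvPolynomial.degreeOf_sum_le _ _ _).trans (Finset.sup_le fun k _ => ?_)
  refine (MvPolynomial.degreeOf_mul_le _ _ _).trans ?_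
  have := h k
  omega

/-- Substituting constants for all variables but `s` and a linear polynomial for `s` does not
increase the degree. -/
lemma natDegree_aeval_le_degreeOf {σ R : Type*} [CommRing R] (f : MvPolynomial σ R)
    (s : σ) (g : σ → R[X]) (hs : (g s).natDegree ≤ 1) (hg : ∀ t, t ≠ s → (g t).natDegree = 0) :
    (MvPolynomial.aeval g f).natDegree ≤ f.degreeOf s := by
  classical
  rw [MvPolynomial.aeval_eq_eval₂Hom, MvPolynomial.coe_eval₂Hom, MvPolynomial.eval₂_eq]
  refine natDegree_sum_le_of_forall_le _ _ fun e he => ?_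
  refine (natDegree_C_mul_le _ _).trans ?_
  refine (natDegree_prod_le _ _).trans ?_
  have h1 : ∀ t ∈ e.support, (g t ^ e t).natDegree ≤ if t = s then e s else 0 := fun t _ => by
    by_cases ht : t = s
    · subst ht
      simpa using natDegree_pow_le_of_le (e t) hs
    · simpa [ht] using natDegree_pow_le_of_le (e t) (hg t ht).le
  refine (Finset.sum_le_sum h1).trans ?_
  rw [Finset.sum_ite_eq']
  have h2 := MvPolynomial.monomial_le_degreeOf s he
  split_ifs
  · exact h2
  · exact Nat.zero_le _

/-- The coefficient of `y_i²` is `∑ k, (E k i)²`, which cannot cancel over the reals: it is nonzero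
unless every `E k i` is zero, and then `y_i` does not occur. -/
lemma degreeOf_some_sumSqForms (E : κ → Fin m → ℝ[X]) (i : Fin m) :
    (sumSqForms E).degreeOf (some i) = 0 ∨ (sumSqForms E).degreeOf (some i) = 2 := by
  by_cases h0 : ∀ k, E k i = 0
  · left
    have := degreeOf_sumSqForms_le (E := E) (s := some i) (d := 0) fun k => by
      simpa [h0 k] using degreeOf_some_linearFormPoly_le (E k) i
    omega
  · right
    have hle := degreeOf_sumSqForms_le (E := E) (s := some i) (d := 1) fun k =>
      (degreeOf_some_linearFormPoly_le (E k) i).trans (by split_ifs <;> simp)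
    refine le_antisymm (by omega) ?_
    push Not at h0
    obtain ⟨k, hk⟩ := h0
    obtain ⟨r, hr⟩ : ∃ r : ℝ, eval r (E k i) ≠ 0 := by
      by_contra hcon
      push Not at hcon
      exact hk (Polynomial.funext fun r => by rw [hcon r, eval_zero])
    -- Setting `x = r`, `y_i = X` and the other `y_j = 0` leaves a positive multiple of `X ^ 2`.
    set g : Option (Fin m) → ℝ[X] := fun s => s.elim (C r) (Pi.single i X) with hg
    have hlin : ∀ v : Fin m → ℝ[X],
        MvPolynomial.aeval g (linearFormPoly v) = C (eval r (v i)) * X := fun v => by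
      have hX : ∀ q : ℝ[X], MvPolynomial.aeval g (aeval (varX m) q) = C (eval r q) := fun q => by
        rw [← Polynomial.aeval_algHom_apply]
        simp only [varX, MvPolynomial.aeval_X, hg, Option.elim]
        have := Polynomial.aeval_algebraMap_apply ℝ[X] r q
        simpa using this
      rw [linearFormPoly, map_sum, Finset.sum_eq_single i]
      · rw [map_mul, hX]; simp [varY, hg]
      · intro j _ hj
        simp [varY, hg, hj]
      · simp
    have hval : MvPolynomial.aeval g (sumSqForms E)
        = C (∑ l, eval r (E l i) * eval r (E l i)) * X ^ 2 := by
      rw [sumSqForms, map_sum, map_sum, Finset.sum_mul]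
      refine Finset.sum_congr rfl fun l _ => ?_
      rw [map_mul, hlin, C_mul]; ring
    have hpos : 0 < ∑ l, eval r (E l i) * eval r (E l i) :=
      Finset.sum_pos' (fun l _ => mul_self_nonneg _)
        ⟨k, Finset.mem_univ k, mul_self_pos.2 hr⟩
    have h1 := natDegree_aeval_le_degreeOf (sumSqForms E) (some i) g
      (by simp [hg]) (fun t ht => by
        rcases t with _ | t
        · simp [hg]
        · have : t ≠ i := fun h => ht (by rw [h])
          simp [hg, this])
    rwa [hval, natDegree_C_mul_X_pow _ _ hpos.ne'] at h1

/-- A sum of squares takes nonnegative values. -/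
lemma eval_nonneg_of_isSumSq {σ : Type*} {f : MvPolynomial σ ℝ} (hf : IsSumSq f) (v : σ → ℝ) :
    0 ≤ MvPolynomial.eval v f := by
  induction hf with
  | zero => simp
  | sq_add a _ ih =>
    rw [map_add, map_mul]
    exact add_nonneg (mul_self_nonneg _) ih

lemma eval_quadFormPoly (P : Matrix (Fin m) (Fin m) ℝ[X]) (x : ℝ) (y : Fin m → ℝ) :
    MvPolynomial.eval (fun s => s.elim x y) (quadFormPoly P)
      = y ⬝ᵥ P.map (eval x) *ᵥ y := by
  have hX : ∀ q : ℝ[X], MvPolynomial.eval (fun s => s.elim x y) (aeval (varX m) q)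
      = eval x q := fun q => by
    have := Polynomial.aeval_algHom_apply
      (MvPolynomial.aeval (R := ℝ) (fun s : Option (Fin m) => s.elim x y)) (varX m) q
    simpa [varX, MvPolynomial.aeval_eq_eval] using this.symm
  rw [quadFormPoly_eq_sum]
  simp only [map_sum, map_mul, hX, dotProduct, mulVec, Finset.mul_sum, map_apply]
  refine Finset.sum_congr rfl fun i _ => Finset.sum_congr rfl fun j _ => ?_
  simp [varY]
  ring

lemma posSemidef_of_isIntervalCertificate {P : Matrix (Fin m) (Fin m) ℝ[X]} (hP : P.IsSymm)
    {a b : ℝ} {lam nu : PolyXY m} (h : IsIntervalCertificate P a b lam nu) {x : ℝ}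
    (hx : x ∈ Set.Icc a b) : (P.map (eval x)).PosSemidef := by
  obtain ⟨hlam, hnu, heven, hodd⟩ := h
  refine PosSemidef.of_dotProduct_mulVec_nonneg ?_ fun y => ?_
  · ext i j
    simp [hP.apply i j]
  · rw [star_trivial, ← eval_quadFormPoly]
    have h1 := eval_nonneg_of_isSumSq hlam (fun s => s.elim x y)
    have h2 := eval_nonneg_of_isSumSq hnu (fun s => s.elim x y)
    have hxa : 0 ≤ x - a := by linarith [hx.1]
    have hxb : 0 ≤ b - x := by linarith [hx.2]
    rcases Nat.even_or_odd (polyMatrixDegree P) with hd | hd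
    · rw [heven hd]
      simp only [map_add, map_mul, map_sub, varX, MvPolynomial.eval_X, MvPolynomial.eval_C,
        Option.elim]
      positivity
    · rw [hodd hd]
      simp only [map_add, map_mul, map_sub, varX, MvPolynomial.eval_X, MvPolynomial.eval_C,
        Option.elim]
      positivity

lemma natDegree_le_polyMatrixDegree (P : Matrix (Fin m) (Fin m) ℝ[X]) (i j : Fin m) :
    (P i j).natDegree ≤ polyMatrixDegree P :=
  Finset.le_sup (f := fun ij : Fin m × Fin m => (P ij.1 ij.2).natDegree) (Finset.mem_univ (i, j))

/-- A matrix polynomial that is positive semidefinite on an interval has a certificate within the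
degree bounds. -/
theorem exists_isIntervalCertificate {P : Matrix (Fin m) (Fin m) ℝ[X]} {a b : ℝ} (hab : a < b)
    (hpos : ∀ x ∈ Set.Icc a b, (P.map (eval x)).PosSemidef) :
    ∃ lam nu : PolyXY m, IsIntervalCertificate P a b lam nu ∧
      (∀ i : Fin m, lam.degreeOf (some i) = 0 ∨ lam.degreeOf (some i) = 2) ∧
      (∀ i : Fin m, nu.degreeOf (some i) = 0 ∨ nu.degreeOf (some i) = 2) ∧
      lam.degreeOf none ≤ 2 * (polyMatrixDegree P / 2) ∧
      (Even (polyMatrixDegree P) →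
        nu = 0 ∨ nu.degreeOf none + 2 ≤ 2 * (polyMatrixDegree P / 2)) ∧
      (Odd (polyMatrixDegree P) →
        nu.degreeOf none ≤ 2 * (polyMatrixDegree P / 2)) := by
  have hN := natDegree_le_polyMatrixDegree P
  obtain ⟨d, hd | hd⟩ := Nat.even_or_odd' (polyMatrixDegree P)
  · have hd2 : polyMatrixDegree P / 2 = d := by omega
    have hnodd : ¬ Odd (polyMatrixDegree P) := by rw [hd]; simp
    obtain ⟨κ, _, E, O, hP, hE, hO0, hO⟩ :=
      exists_interval_sum_even (fun i j => (hN i j).trans_eq hd) hab hpos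
    have hq := quadFormPoly_eq_add (P := P) (E := E) (O := O) 1 ((X - C a) * (C b - X))
      fun i j => by rw [hP, one_mul]
    refine ⟨sumSqForms E, sumSqForms O, ⟨isSumSq_sumSqForms E, isSumSq_sumSqForms O, fun _ => ?_,
      fun h => absurd h hnodd⟩, degreeOf_some_sumSqForms E, degreeOf_some_sumSqForms O, ?_,
      fun _ => ?_, fun h => absurd h hnodd⟩
    · simpa [MvPolynomial.algebraMap_eq] using hq
    · rw [hd2]
      exact degreeOf_sumSqForms_le fun k => degreeOf_none_linearFormPoly_le (hE k)
    -- For `d = 0` the truncated `d - 1` carries no information, so the vanishing of `O` is used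
    -- instead.
    · rcases Nat.eq_zero_or_pos d with h0 | h0
      · left
        simp [sumSqForms, linearFormPoly, hO0 h0]
      · right
        have := degreeOf_sumSqForms_le (E := O) fun k => degreeOf_none_linearFormPoly_le (hO k)
        omega
  · have hd2 : polyMatrixDegree P / 2 = d := by omega
    have hneven : ¬ Even (polyMatrixDegree P) := by
      rw [Nat.not_even_iff_odd]; exact ⟨d, hd⟩
    obtain ⟨κ, _, E, O, hP, hE, hO⟩ :=
      exists_interval_sum_odd (fun i j => (hN i j).trans_eq hd) hab hpos
    have hq := quadFormPoly_eq_add (P := P) (E := E) (O := O) (X - C a) (C b - X) hP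
    refine ⟨sumSqForms E, sumSqForms O, ⟨isSumSq_sumSqForms E, isSumSq_sumSqForms O,
      fun h => absurd h hneven, fun _ => ?_⟩, degreeOf_some_sumSqForms E,
      degreeOf_some_sumSqForms O, ?_, fun h => absurd h hneven, fun _ => ?_⟩
    · simpa [MvPolynomial.algebraMap_eq] using hq
    · rw [hd2]
      exact degreeOf_sumSqForms_le fun k => degreeOf_none_linearFormPoly_le (hE k)
    · rw [hd2]
      exact degreeOf_sumSqForms_le fun k => degreeOf_none_linearFormPoly_le (hO k)

end Certificate

theorem theorem3 (m : ℕ) (P : Matrix (Fin m) (Fin m) ℝ[X]) (hP : P.IsSymm)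
    (a b : ℝ) (hab : a < b) :
    -- P is positive semidefinite on [a, b] iff there is a certificate
    ((∀ x ∈ Set.Icc a b, (P.map (Polynomial.eval x)).PosSemidef) ↔
      ∃ lam nu : PolyXY m, IsIntervalCertificate P a b lam nu) ∧
    -- moreover, the certificate can be chosen within the degree bounds
    ((∀ x ∈ Set.Icc a b, (P.map (Polynomial.eval x)).PosSemidef) →
      ∃ lam nu : PolyXY m, IsIntervalCertificate P a b lam nu ∧
        (∀ i : Fin m, lam.degreeOf (some i) = 0 ∨ lam.degreeOf (some i) = 2) ∧
        (∀ i : Fin m, nu.degreeOf (some i) = 0 ∨ nu.degreeOf (some i) = 2) ∧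
        lam.degreeOf none ≤ 2 * (polyMatrixDegree P / 2) ∧
        -- in the even case, a bound by 2d - 2 with d = 0 says nu = 0
        (Even (polyMatrixDegree P) →
          nu = 0 ∨ nu.degreeOf none + 2 ≤ 2 * (polyMatrixDegree P / 2)) ∧
        (Odd (polyMatrixDegree P) →
          nu.degreeOf none ≤ 2 * (polyMatrixDegree P / 2))) := by
  have hex := exists_isIntervalCertificate (P := P) hab
  refine ⟨⟨fun h => ?_, fun ⟨_, _, h⟩ x hx => posSemidef_of_isIntervalCertificate hP h hx⟩, hex⟩
  obtain ⟨lam, nu, h, -⟩ := hex h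
  exact ⟨lam, nu, h⟩
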